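/- Let $d\ge 1$, let $B\in M_d(\mathbb C)$ be a correlation matrix (that is, $B\ge 0$ and $B_{ii}=1$ for all $i$), and let $\Phi_B:M_d(\mathbb C)\to M_d(\mathbb C)$, $\Phi_B(X)=B\odot X$ (entrywise product), be the associated generalized dephasing (Hadamard) channel. For a quantum channel (completely positive trace-preserving linear map) $\Phi:M_{d}(\mathbb C)\to M_{d'}(\mathbb C)$, let $$\mathcal Q^{(1)}(\Phi)=\sup_\rho\big(S(\Phi(\rho))-S(\Phi_c(\rho))\big),\qquad \mathcal Q(\Phi)=\lim_{n\to\infty}\frac{\mathcal Q^{(1)}(\Phi^{\otimes n})}{n},$$ where $\rho$ ranges over all states (positive semidefinite matrices of trace one), $S(\rho)=-\operatorname{Tr}(\rho\log\rho)$ is the von Neumann entropy, and $\Phi_c$ is any channel complementary to $\Phi$: for some isometry $V:\mathbb C^{d}\to\mathbb C^{d'}\otimes\mathbb C^{e}$ one has $\Phi(X)=\operatorname{Tr}_{2}(VXV^\dagger)$ and $\Phi_c(X)=\operatorname{Tr}_{1}(VXV^\dagger)$ for all $X$ (the value of $S(\Phi_c(\rho))$ does not depend on the choice of $\Phi_c$).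 A channel $\Phi$ is entanglement-breaking if its Choi matrix $J(\Phi)=(\Phi\otimes\mathrm{id})(|\Omega\rangle\langle\Omega|)$, $|\Omega\rangle=\sum_i|i\rangle|i\rangle$, is separable, i.e. a finite sum of tensor products of positive semidefinite matrices; it is PPT if $\top\circ\Phi$ is again a channel, where $\top$ is the transpose map. Then the limit defining the quantum capacity $\mathcal Q(\Phi_B)$ exists in $\mathbb R$, and the following are equivalent: 1. $\mathcal Q(\Phi_B)=0$; 2. $\Phi_B$ is entanglement-breaking; 3. $\Phi_B$ is PPT; 4. $B=\mathbb 1_d$, the $d\times d$ identity matrix. -/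

import Mathlib

open Filter Topology
open scoped Matrix Kronecker ComplexOrder

namespace QChannel

noncomputable section

/-- `Φ ⊗ id` on `M_a ⊗ M_n`, for a linear map `Φ : M_a → M_b`: the map `Φ` is applied to each
block (with respect to the second tensor factor) of the argument. -/
def ampliation {a b : Type*} (n : Type*)
    (Φ : Matrix a a ℂ →ₗ[ℂ] Matrix b b ℂ) (X : Matrix (a × n) (a × n) ℂ) :
    Matrix (b × n) (b × n) ℂ :=
  Matrix.of fun p q => Φ (Matrix.of fun i j => X (i, p.2) (j, q.2)) p.1 q.1

/-- Check of the definition on product matrices: `(Φ ⊗ id)(X ⊗ Y) = Φ(X) ⊗ Y`. -/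
theorem ampliation_kronecker {a b n : Type*}
    (Φ : Matrix a a ℂ →ₗ[ℂ] Matrix b b ℂ) (X : Matrix a a ℂ) (Y : Matrix n n ℂ) :
    ampliation n Φ (X ⊗ₖ Y) = Φ X ⊗ₖ Y := by
  ext p q
  have h : (Matrix.of fun i j => (X ⊗ₖ Y) (i, p.2) (j, q.2)) = Y p.2 q.2 • X := by
    ext i j
    simp [Matrix.kroneckerMap_apply, mul_comm]
  change Φ (Matrix.of fun i j => (X ⊗ₖ Y) (i, p.2) (j, q.2)) p.1 q.1 = Φ X p.1 q.1 * Y p.2 q.2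
  rw [h, map_smul, Matrix.smul_apply, smul_eq_mul, mul_comm]

/-- A quantum channel: a completely positive and trace preserving linear map of matrices. -/
structure IsChannel {a b : Type*} [Fintype a] [Fintype b]
    (Φ : Matrix a a ℂ →ₗ[ℂ] Matrix b b ℂ) : Prop where
  completelyPositive : ∀ (n : ℕ) (X : Matrix (a × Fin n) (a × Fin n) ℂ),
    X.PosSemidef → (ampliation (Fin n) Φ X).PosSemidef
  tracePreserving : ∀ X : Matrix a a ℂ, (Φ X).trace = X.trace

/-- A quantum state: a positive semidefinite matrix of trace one. -/
structure IsState {a : Type*} [Fintype a] (ρ : Matrix a a ℂ) : Prop where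
  posSemidef : ρ.PosSemidef
  trace_eq_one : ρ.trace = 1

/-- The partial trace over the second tensor factor. -/
def traceSnd {b e : Type*} [Fintype e] (M : Matrix (b × e) (b × e) ℂ) : Matrix b b ℂ :=
  Matrix.of fun i j => ∑ x, M (i, x) (j, x)

/-- The partial trace over the first tensor factor. -/
def traceFst {b e : Type*} [Fintype b] (M : Matrix (b × e) (b × e) ℂ) : Matrix e e ℂ :=
  Matrix.of fun x y => ∑ i, M (i, x) (i, y)

/-- `Φ : M_a → M_b` and `Φc : M_a → M_e` are complementary: there is an isometry
`V : ℂ^a → ℂ^b ⊗ ℂ^e` such that `Φ(X) = Tr_e (V X V†)` and `Φc(X) = Tr_b (V X V†)`. -/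
def IsComplementary {a b e : Type*} [Fintype a] [DecidableEq a] [Fintype b] [Fintype e]
    (Φ : Matrix a a ℂ →ₗ[ℂ] Matrix b b ℂ) (Φc : Matrix a a ℂ →ₗ[ℂ] Matrix e e ℂ) : Prop :=
  ∃ V : Matrix (b × e) a ℂ, Vᴴ * V = 1 ∧
    ∀ X, Φ X = traceSnd (V * X * Vᴴ) ∧ Φc X = traceFst (V * X * Vᴴ)

/-- The von Neumann entropy `S(ρ) = - Tr (ρ log ρ)` (natural logarithm; the logarithm of a matrix
is taken in the functional calculus, with `log 0 = 0`, so that `0 log 0 = 0`). -/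
def entropy {a : Type*} [Fintype a] [DecidableEq a] (ρ : Matrix a a ℂ) : ℝ :=
  -(ρ * cfc Real.log ρ).trace.re

/-- The coherent information `Q⁽¹⁾(Φ)` of a channel `Φ`: the maximum over all states `ρ` of
`S(Φ(ρ)) - S(Φc(ρ))`, where `Φc` is complementary to `Φ`. As `S(Φc(ρ))` is the same for all
complementary channels `Φc`, taking the supremum over `Φc` as well makes no difference. -/
def coherentInfo {a b : Type*} [Fintype a] [DecidableEq a] [Fintype b] [DecidableEq b]
    (Φ : Matrix a a ℂ →ₗ[ℂ] Matrix b b ℂ) : ℝ :=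
  sSup {x : ℝ | ∃ (m : ℕ) (Φc : Matrix a a ℂ →ₗ[ℂ] Matrix (Fin m) (Fin m) ℂ)
    (ρ : Matrix a a ℂ), IsComplementary Φ Φc ∧ IsState ρ ∧
      x = entropy (Φ ρ) - entropy (Φc ρ)}

/-- The tensor power `Φ^{⊗ n} : M_a^{⊗ n} → M_b^{⊗ n}`, where the matrices in `M_a^{⊗ n}` are
indexed by `Fin n → a`: it maps the matrix unit `⊗_t E_{i_t j_t}` to `⊗_t Φ(E_{i_t j_t})`. -/
def tensorPower {a b : Type*} [Fintype a] [DecidableEq a]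
    (Φ : Matrix a a ℂ →ₗ[ℂ] Matrix b b ℂ) (n : ℕ) :
    Matrix (Fin n → a) (Fin n → a) ℂ →ₗ[ℂ] Matrix (Fin n → b) (Fin n → b) ℂ where
  toFun X := Matrix.of fun k l =>
    ∑ i, ∑ j, X i j * ∏ t, Φ (Matrix.single (i t) (j t) 1) (k t) (l t)
  map_add' X Y := by
    ext k l
    simp [add_mul, Finset.sum_add_distrib]
  map_smul' c X := by
    ext k l
    simp [mul_assoc, Finset.mul_sum]

/-- Check of the definition on product matrices: `Φ^{⊗ n}(⊗_t X_t) = ⊗_t Φ(X_t)`. -/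
theorem tensorPower_product {a b : Type*} [Fintype a] [DecidableEq a]
    (Φ : Matrix a a ℂ →ₗ[ℂ] Matrix b b ℂ) (n : ℕ) (X : Fin n → Matrix a a ℂ) :
    tensorPower Φ n (Matrix.of fun i j => ∏ t, X t (i t) (j t)) =
      Matrix.of fun k l => ∏ t, Φ (X t) (k t) (l t) := by
  have h : ∀ (Y : Matrix a a ℂ) (k l : b),
      Φ Y k l = ∑ p : a × a, Y p.1 p.2 * Φ (Matrix.single p.1 p.2 1) k l := by
    intro Y k l
    conv_lhs => rw [Matrix.matrix_eq_sum_single Y]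
    simp only [map_sum, Matrix.sum_apply, Fintype.sum_prod_type]
    refine Finset.sum_congr rfl fun i _ => Finset.sum_congr rfl fun j _ => ?_
    have : Matrix.single i j (Y i j) = Y i j • Matrix.single i j (1 : ℂ) := by simp
    rw [this, map_smul, Matrix.smul_apply, smul_eq_mul]
  ext k l
  change ∑ i : Fin n → a, ∑ j : Fin n → a, (∏ t, X t (i t) (j t)) *
      ∏ t, Φ (Matrix.single (i t) (j t) 1) (k t) (l t) = ∏ t, Φ (X t) (k t) (l t)
  rw [Finset.prod_congr rfl fun t _ => h (X t) (k t) (l t), Finset.prod_univ_sum,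
    Fintype.piFinset_univ, ← Fintype.sum_prod_type']
  refine (Fintype.sum_equiv (Equiv.arrowProdEquivProdArrow (Fin n) (fun _ => a) (fun _ => a))
    _ _ fun p => ?_).symm
  simp [Finset.prod_mul_distrib, Equiv.arrowProdEquivProdArrow]

/-- The quantum capacity `Q(Φ) = lim_{n → ∞} Q⁽¹⁾(Φ^{⊗ n}) / n`. -/
def quantumCapacity {a b : Type*} [Fintype a] [DecidableEq a] [Fintype b] [DecidableEq b]
    (Φ : Matrix a a ℂ →ₗ[ℂ] Matrix b b ℂ) : ℝ :=
  limUnder atTop fun n : ℕ => coherentInfo (tensorPower Φ n) / n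

/-- The (unnormalized) maximally entangled projector `|Ω⟩⟨Ω|`, where `|Ω⟩ = ∑_i |i⟩ ⊗ |i⟩`. -/
def maxEntangled (a : Type*) [DecidableEq a] : Matrix (a × a) (a × a) ℂ :=
  Matrix.vecMulVec (fun p => if p.1 = p.2 then 1 else 0)
    (star fun p => if p.1 = p.2 then 1 else 0)

/-- The Choi matrix `J(Φ) = (Φ ⊗ id)(|Ω⟩⟨Ω|)`. -/
def choi {a b : Type*} [DecidableEq a] (Φ : Matrix a a ℂ →ₗ[ℂ] Matrix b b ℂ) :
    Matrix (b × a) (b × a) ℂ :=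
  ampliation a Φ (maxEntangled a)

/-- A (not necessarily normalized) bipartite matrix is separable if it is a finite sum of tensor
products of positive semidefinite matrices. -/
def IsSeparable {b a : Type*} (M : Matrix (b × a) (b × a) ℂ) : Prop :=
  ∃ (m : ℕ) (P : Fin m → Matrix b b ℂ) (R : Fin m → Matrix a a ℂ),
    (∀ k, (P k).PosSemidef) ∧ (∀ k, (R k).PosSemidef) ∧ M = ∑ k, P k ⊗ₖ R k

/-- Entanglement-breaking channels: the Choi matrix is separable. -/
def IsEntanglementBreaking {a b : Type*} [Fintype a] [DecidableEq a] [Fintype b]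
    (Φ : Matrix a a ℂ →ₗ[ℂ] Matrix b b ℂ) : Prop :=
  IsChannel Φ ∧ IsSeparable (choi Φ)

/-- The transpose map on matrices. -/
def transposeMap (b : Type*) : Matrix b b ℂ →ₗ[ℂ] Matrix b b ℂ :=
  (Matrix.transposeLinearEquiv b b ℂ ℂ).toLinearMap

/-- PPT channels: channels whose composition with the transpose map is again a channel. -/
def IsPPT {a b : Type*} [Fintype a] [Fintype b]
    (Φ : Matrix a a ℂ →ₗ[ℂ] Matrix b b ℂ) : Prop :=
  IsChannel Φ ∧ IsChannel (transposeMap b ∘ₗ Φ)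

/-- Correlation matrices: positive semidefinite with all diagonal entries equal to one. -/
structure IsCorrelation {a : Type*} (B : Matrix a a ℂ) : Prop where
  posSemidef : B.PosSemidef
  diag_eq_one : ∀ i, B i i = 1

/-- The generalized dephasing (Hadamard) map `Φ_B(X) = B ⊙ X`. -/
def dephasing {a : Type*} (B : Matrix a a ℂ) : Matrix a a ℂ →ₗ[ℂ] Matrix a a ℂ where
  toFun X := B ⊙ X
  map_add' X Y := Matrix.hadamard_add B X Y
  map_smul' c X := Matrix.hadamard_smul B X c

/-- If `B` is a correlation matrix, then `Φ_B` is a channel. -/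
theorem isChannel_dephasing {a : Type*} [Fintype a] {B : Matrix a a ℂ} (hB : IsCorrelation B) :
    IsChannel (dephasing B) where
  completelyPositive n X hX := by
    have h : ampliation (Fin n) (dephasing B) X = (B.submatrix Prod.fst Prod.fst) ⊙ X := by
      ext p q
      simp [ampliation, dephasing]
    rw [h]
    exact (hB.posSemidef.submatrix _).hadamard hX
  tracePreserving X := by
    simp [dephasing, Matrix.trace, hB.diag_eq_one]

end

end QChannel

/-! Positivity of the capacity comes from one input state. At the maximally mixed state the output
of `Φ_B` is maximally mixed, with entropy `log d`, while the environment receives a state with the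
spectrum of `Bᵀ / d`, whose entropy is below `log d` unless `B = 1` (`coherentInfo_dephasing_pos`).
Product inputs make the coherent information superadditive over tensor powers
(`add_coherentInfo_le`), so Fekete's lemma gives the limit and shows that it is at least the
one-copy value. If `B = 1`, the output and the environment have equal entropy for every input and
every tensor power, so the capacity is `0`.

All this rests on the shape of a complementary channel: an isometry dilating `Φ_B` must send `e_i`
to `e_i ⊗ w_i`, where the `w_i` have Gram matrix `B`. The environment entropy is then that of the
explicit matrix `envGram B ρ`, and tensor powers of `Φ_B` are again dephasing maps.

The entanglement conditions use only that a zero diagonal entry of a positive semidefinite matrix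
annihilates its row, applied to the factors of a separable decomposition or to the partial transpose
of the Choi matrix. -/

namespace QChannel

noncomputable section

open Real (negMulLog)

/-! ### States and positive semidefinite matrices. -/

section States

variable {a b : Type*} [Fintype a] [Fintype b]

theorem IsState.nonempty {ρ : Matrix a a ℂ} (hρ : IsState ρ) : Nonempty a := by
  by_contra h
  rw [not_nonempty_iff] at h
  simpa [Matrix.trace] using hρ.trace_eq_one

theorem IsState.kronecker {ρ : Matrix a a ℂ} {σ : Matrix b b ℂ} (hρ : IsState ρ)
    (hσ : IsState σ) : IsState (ρ ⊗ₖ σ) where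
  posSemidef := hρ.posSemidef.kronecker hσ.posSemidef
  trace_eq_one := by rw [Matrix.trace_kronecker, hρ.trace_eq_one, hσ.trace_eq_one, one_mul]

theorem IsState.submatrix_equiv {ρ : Matrix a a ℂ} (hρ : IsState ρ) (e : b ≃ a) :
    IsState (ρ.submatrix e e) where
  posSemidef := hρ.posSemidef.submatrix e
  trace_eq_one := by
    rw [← hρ.trace_eq_one]
    exact Equiv.sum_comp e fun i => ρ i i

open scoped MatrixOrder in
theorem _root_.Matrix.PosSemidef.exists_eq_conjTranspose_mul_self {M : Matrix a a ℂ}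
    (hM : M.PosSemidef) : ∃ K : Matrix a a ℂ, M = Kᴴ * K := by
  classical
  exact CStarAlgebra.nonneg_iff_eq_star_mul_self.mp hM.nonneg

/-- In a factorization `M = Kᴴ * K`, the entry `M i i` is the squared norm of column `i` of `K`, so
that column vanishes. -/
theorem _root_.Matrix.PosSemidef.apply_eq_zero_of_diag_eq_zero {M : Matrix a a ℂ}
    (hM : M.PosSemidef) {i : a} (hi : M i i = 0) (j : a) : M i j = 0 := by
  obtain ⟨K, rfl⟩ := hM.exists_eq_conjTranspose_mul_self
  have h : (fun x => K x i) = 0 := by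
    rw [← dotProduct_star_self_eq_zero, ← hi]
    simp [Matrix.mul_apply, dotProduct, mul_comm]
  rw [Matrix.mul_apply]
  refine Finset.sum_eq_zero fun x _ => ?_
  rw [Matrix.conjTranspose_apply, show K x i = 0 from congrFun h x, star_zero, zero_mul]

end States

/-! ### Von Neumann entropy: spectral formula, additivity, extremal values. -/

section Entropy

variable {a b : Type*} [Fintype a] [DecidableEq a] [Fintype b] [DecidableEq b]

theorem entropy_eq_sum_eigenvalues {ρ : Matrix a a ℂ} (hρ : ρ.IsHermitian) :
    entropy ρ = ∑ i, negMulLog (hρ.eigenvalues i) := by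
  have h : ρ * cfc Real.log ρ = cfc (fun x => x * Real.log x) ρ := by
    have hc : ∀ f : ℝ → ℝ, ContinuousOn f (spectrum ℝ ρ) := fun f =>
      (Matrix.finite_real_spectrum (A := ρ)).continuousOn f
    rw [cfc_mul (fun x => x) Real.log ρ (hc _) (hc _),
      cfc_id' ℝ ρ (ha := hρ.isSelfAdjoint)]
  rw [entropy, h, hρ.cfc_eq, Matrix.IsHermitian.cfc, Unitary.conjStarAlgAut_apply,
    Matrix.trace_mul_cycle, Unitary.coe_star_mul_self, one_mul, Matrix.trace_diagonal]
  simp [negMulLog]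

theorem entropy_eq_sum_roots {ρ : Matrix a a ℂ} (hρ : ρ.IsHermitian) :
    entropy ρ = (ρ.charpoly.roots.map fun z => negMulLog z.re).sum := by
  rw [entropy_eq_sum_eigenvalues hρ, hρ.roots_charpoly_eq_eigenvalues, Multiset.map_map]
  simp

/-- The entropy only depends on the nonzero part of the spectrum. -/
theorem entropy_congr {ρ : Matrix a a ℂ} {σ : Matrix b b ℂ} (hρ : ρ.IsHermitian)
    (hσ : σ.IsHermitian) (m n : ℕ)
    (h : Polynomial.X ^ m * ρ.charpoly = Polynomial.X ^ n * σ.charpoly) :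
    entropy ρ = entropy σ := by
  -- The factor `X ^ k` only adds roots at `0`, where `negMulLog` vanishes.
  have key : ∀ (k : ℕ) (p : Polynomial ℂ), p.Monic →
      ((Polynomial.X ^ k * p).roots.map fun z : ℂ => negMulLog z.re).sum =
        (p.roots.map fun z => negMulLog z.re).sum := by
    intro k p hp
    rw [Polynomial.roots_mul (mul_ne_zero (pow_ne_zero _ Polynomial.X_ne_zero) hp.ne_zero)]
    simp [Multiset.map_nsmul, Multiset.sum_nsmul]
  rw [entropy_eq_sum_roots hρ, entropy_eq_sum_roots hσ, ← key m _ (Matrix.charpoly_monic _), h,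
    key n _ (Matrix.charpoly_monic _)]

theorem entropy_self_mul_conjTranspose (K : Matrix a b ℂ) :
    entropy (K * Kᴴ) = entropy (Kᴴ * K) :=
  entropy_congr (Matrix.isHermitian_mul_conjTranspose_self K)
    (Matrix.isHermitian_conjTranspose_mul_self K) _ _ (Matrix.charpoly_mul_comm' K Kᴴ)

theorem entropy_submatrix_equiv {ρ : Matrix a a ℂ} (hρ : ρ.IsHermitian) (e : b ≃ a) :
    entropy (ρ.submatrix e e) = entropy ρ := by
  refine entropy_congr (hρ.submatrix _) hρ 0 0 ?_
  rw [← Matrix.charpoly_reindex e.symm ρ]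
  simp [Matrix.reindex_apply]

theorem entropy_diagonal (x : a → ℝ) :
    entropy (Matrix.diagonal fun i => (x i : ℂ)) = ∑ i, negMulLog (x i) := by
  have h : (Matrix.diagonal fun i => (x i : ℂ)).IsHermitian :=
    Matrix.isHermitian_diagonal_of_self_adjoint _ (by
      ext i; simp)
  rw [entropy_eq_sum_roots h, Matrix.charpoly_diagonal,
    Polynomial.roots_prod _ _ (Finset.prod_ne_zero_iff.mpr fun i _ => Polynomial.X_sub_C_ne_zero _)]
  simp [Multiset.bind_singleton]

theorem entropy_conj {ρ : Matrix a a ℂ} (hρ : ρ.IsHermitian) {U : Matrix a a ℂ}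
    (hU : Uᴴ * U = 1) : entropy (U * ρ * Uᴴ) = entropy ρ := by
  refine entropy_congr (Matrix.isHermitian_mul_mul_conjTranspose U hρ) hρ 0 0 ?_
  rw [Matrix.charpoly_mul_comm, ← mul_assoc, hU, one_mul]

theorem IsState.sum_eigenvalues {ρ : Matrix a a ℂ} (hρ : IsState ρ) :
    ∑ i, hρ.posSemidef.1.eigenvalues i = 1 := by
  have h := hρ.posSemidef.1.trace_eq_sum_eigenvalues
  rw [hρ.trace_eq_one] at h
  simpa using (congrArg Complex.re h).symm

theorem _root_.Matrix.IsHermitian.eq_unitary_mul_diagonal {ρ : Matrix a a ℂ}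
    (hρ : ρ.IsHermitian) :
    ∃ U : Matrix a a ℂ, Uᴴ * U = 1 ∧ U * Uᴴ = 1 ∧
      ρ = U * (Matrix.diagonal fun i => (hρ.eigenvalues i : ℂ)) * Uᴴ :=
  ⟨hρ.eigenvectorUnitary, Unitary.coe_star_mul_self _, Unitary.coe_mul_star_self _,
    hρ.spectral_theorem⟩

theorem IsState.entropy_kronecker {ρ : Matrix a a ℂ} {σ : Matrix b b ℂ} (hρ : IsState ρ)
    (hσ : IsState σ) : entropy (ρ ⊗ₖ σ) = entropy ρ + entropy σ := by
  obtain ⟨U, hU, -, hUρ⟩ := hρ.posSemidef.1.eq_unitary_mul_diagonal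
  obtain ⟨W, hW, -, hWσ⟩ := hσ.posSemidef.1.eq_unitary_mul_diagonal
  have hx := hρ.sum_eigenvalues
  have hy := hσ.sum_eigenvalues
  rw [entropy_eq_sum_eigenvalues hρ.posSemidef.1, entropy_eq_sum_eigenvalues hσ.posSemidef.1]
  set x := hρ.posSemidef.1.eigenvalues
  set y := hσ.posSemidef.1.eigenvalues
  have hd : (Matrix.diagonal fun i => (x i : ℂ)) ⊗ₖ (Matrix.diagonal fun i => (y i : ℂ)) =
      Matrix.diagonal fun p : a × b => ((x p.1 * y p.2 : ℝ) : ℂ) := by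
    rw [Matrix.diagonal_kronecker_diagonal]
    simp
  have hUW : (U ⊗ₖ W)ᴴ * (U ⊗ₖ W) = 1 := by
    rw [Matrix.conjTranspose_kronecker, ← Matrix.mul_kronecker_mul, hU, hW,
      Matrix.one_kronecker_one]
  have hD : (Matrix.diagonal fun p : a × b => ((x p.1 * y p.2 : ℝ) : ℂ)).IsHermitian :=
    Matrix.isHermitian_diagonal_of_self_adjoint _ (by
      ext i; simp)
  have e : ρ ⊗ₖ σ = (U ⊗ₖ W) *
      (Matrix.diagonal fun p : a × b => ((x p.1 * y p.2 : ℝ) : ℂ)) * (U ⊗ₖ W)ᴴ := by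
    rw [← hd, Matrix.conjTranspose_kronecker, ← Matrix.mul_kronecker_mul,
      ← Matrix.mul_kronecker_mul, ← hUρ, ← hWσ]
  rw [e, entropy_conj hD hUW, entropy_diagonal, Fintype.sum_prod_type]
  -- Both spectra sum to `1`, which removes the weights left by the product rule for `negMulLog`.
  simp only [Real.negMulLog_mul, Finset.sum_add_distrib, ← Finset.sum_mul, ← Finset.mul_sum, hx, hy,
    one_mul]

theorem IsState.entropy_nonneg {ρ : Matrix a a ℂ} (hρ : IsState ρ) : 0 ≤ entropy ρ := by
  rw [entropy_eq_sum_eigenvalues hρ.posSemidef.1]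
  refine Finset.sum_nonneg fun i _ => Real.negMulLog_nonneg (hρ.posSemidef.eigenvalues_nonneg i) ?_
  rw [← hρ.sum_eigenvalues]
  exact Finset.single_le_sum (fun j _ => hρ.posSemidef.eigenvalues_nonneg j) (Finset.mem_univ i)

theorem IsState.entropy_le {ρ : Matrix a a ℂ} (hρ : IsState ρ) :
    entropy ρ ≤ Real.log (Fintype.card a) := by
  have := hρ.nonempty
  have hc : (0 : ℝ) < Fintype.card a := by exact_mod_cast Fintype.card_pos
  -- Jensen's inequality for the eigenvalues with uniform weights, whose mean is `1 / card a`.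
  have h := Real.concaveOn_negMulLog.le_map_sum (t := Finset.univ)
    (w := fun _ : a => (Fintype.card a : ℝ)⁻¹) (p := hρ.posSemidef.1.eigenvalues)
    (fun _ _ => by positivity) (by simp [hc.ne'])
    (fun i _ => hρ.posSemidef.eigenvalues_nonneg i)
  simp only [smul_eq_mul, ← Finset.mul_sum, hρ.sum_eigenvalues,
    ← entropy_eq_sum_eigenvalues hρ.posSemidef.1] at h
  rw [mul_one, negMulLog, Real.log_inv, neg_mul_neg] at h
  exact le_of_mul_le_mul_left h (by positivity)

/-- Equality in Jensen's inequality for the strictly concave `negMulLog` makes all eigenvalues equal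
to their mean. -/
theorem IsState.eq_of_entropy_eq {ρ : Matrix a a ℂ} (hρ : IsState ρ)
    (h : entropy ρ = Real.log (Fintype.card a)) : ρ = ((Fintype.card a : ℂ)⁻¹) • 1 := by
  have := hρ.nonempty
  have hc : (0 : ℝ) < Fintype.card a := by exact_mod_cast Fintype.card_pos
  have h' := Real.strictConcaveOn_negMulLog.map_sum_eq_iff (t := Finset.univ)
    (w := fun _ : a => (Fintype.card a : ℝ)⁻¹) (p := hρ.posSemidef.1.eigenvalues)
    (fun _ _ => by positivity) (by simp [hc.ne'])
    (fun i _ => hρ.posSemidef.eigenvalues_nonneg i)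
  simp only [smul_eq_mul, ← Finset.mul_sum, hρ.sum_eigenvalues,
    ← entropy_eq_sum_eigenvalues hρ.posSemidef.1] at h'
  rw [h, mul_one, negMulLog, Real.log_inv, neg_mul_neg] at h'
  have hv := h'.mp rfl
  obtain ⟨U, -, hU, hUρ⟩ := hρ.posSemidef.1.eq_unitary_mul_diagonal
  have hd : (Matrix.diagonal fun i => (hρ.posSemidef.1.eigenvalues i : ℂ)) =
      ((Fintype.card a : ℂ)⁻¹) • 1 := by
    rw [Matrix.smul_one_eq_diagonal]
    congr 1
    ext i
    rw [hv i (Finset.mem_univ i)]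
    simp
  rw [hd] at hUρ
  rw [hUρ, Matrix.mul_smul, mul_one, Matrix.smul_mul, hU]

end Entropy

/-! ### Coherent information of a single dephasing channel. -/

section Dephasing

variable {a b : Type*} [Fintype a] [DecidableEq a] [Fintype b] [DecidableEq b]

/-- The matrix with entries `√ρᵢᵢ √ρⱼⱼ Bⱼᵢ`: it has the same entropy as the output on `ρ` of any
channel complementary to the dephasing channel of `B`. -/
def envGram {a : Type*} (B ρ : Matrix a a ℂ) : Matrix a a ℂ :=
  Matrix.of fun i j => (√(ρ i i).re * √(ρ j j).re : ℝ) * B j i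

omit [DecidableEq a] in
theorem IsState.hadamard {B ρ : Matrix a a ℂ} (hB : IsCorrelation B) (hρ : IsState ρ) :
    IsState (dephasing B ρ) where
  posSemidef := hB.posSemidef.hadamard hρ.posSemidef
  trace_eq_one := by rw [(isChannel_dephasing hB).tracePreserving, hρ.trace_eq_one]

omit [DecidableEq a] in
theorem IsState.diag_re_nonneg {ρ : Matrix a a ℂ} (hρ : IsState ρ) (i : a) :
    0 ≤ (ρ i i).re := (Complex.nonneg_iff.mp hρ.posSemidef.diag_nonneg).1

omit [DecidableEq a] in
theorem IsState.ofReal_diag_re {ρ : Matrix a a ℂ} (hρ : IsState ρ) (i : a) :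
    (((ρ i i).re : ℝ) : ℂ) = ρ i i :=
  Complex.ext rfl (Complex.nonneg_iff.mp hρ.posSemidef.diag_nonneg).2

omit [DecidableEq a] in
theorem IsState.sqrt_mul_sqrt_diag {ρ : Matrix a a ℂ} (hρ : IsState ρ) (i : a) :
    ((√(ρ i i).re : ℝ) : ℂ) * ((√(ρ i i).re : ℝ) : ℂ) = ρ i i := by
  rw [← Complex.ofReal_mul, Real.mul_self_sqrt (hρ.diag_re_nonneg i), hρ.ofReal_diag_re]

omit [Fintype a] [DecidableEq a] [DecidableEq b] in
/-- A factor `W` of `B` yields a factor of `envGram B ρ` by rescaling the columns of `W`. -/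
theorem envGram_eq_conjTranspose_mul_self {B ρ : Matrix a a ℂ}
    {W : Matrix b a ℂ} (hW : ∀ i j, ∑ x, W x i * star (W x j) = B i j) :
    envGram B ρ = (Matrix.of fun x i => W x i * (√(ρ i i).re : ℝ))ᴴ *
      (Matrix.of fun x i => W x i * (√(ρ i i).re : ℝ)) := by
  ext i j
  simp only [envGram, Matrix.of_apply, Matrix.mul_apply, Matrix.conjTranspose_apply, ← hW,
    Finset.mul_sum, star_mul']
  refine Finset.sum_congr rfl fun x _ => ?_
  simp
  ring

omit [DecidableEq a] in
theorem IsCorrelation.exists_factor {B : Matrix a a ℂ} (hB : IsCorrelation B) :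
    ∃ W : Matrix a a ℂ, ∀ i j, ∑ x, W x i * star (W x j) = B i j := by
  obtain ⟨K, hK⟩ := hB.posSemidef.exists_eq_conjTranspose_mul_self
  refine ⟨K.map star, fun i j => ?_⟩
  rw [hK]
  simp [Matrix.mul_apply]

omit [DecidableEq a] in
theorem IsState.envGram {B ρ : Matrix a a ℂ} (hB : IsCorrelation B) (hρ : IsState ρ) :
    IsState (envGram B ρ) where
  posSemidef := by
    obtain ⟨W, hW⟩ := hB.exists_factor
    rw [envGram_eq_conjTranspose_mul_self hW]
    exact Matrix.posSemidef_conjTranspose_mul_self _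
  trace_eq_one := by
    rw [← hρ.trace_eq_one]
    refine Finset.sum_congr rfl fun i _ => ?_
    rw [Matrix.diag_apply, Matrix.diag_apply, ← hρ.sqrt_mul_sqrt_diag i]
    simp only [QChannel.envGram, Matrix.of_apply, hB.diag_eq_one, mul_one, Complex.ofReal_mul]

/-- The output entropy of a channel complementary to a dephasing channel. -/
theorem IsComplementary.entropy_eq {e : Type*} [Fintype e] [DecidableEq e] {B ρ : Matrix a a ℂ}
    (hρ : IsState ρ) {Φc : Matrix a a ℂ →ₗ[ℂ] Matrix e e ℂ}
    (h : IsComplementary (dephasing B) Φc) : entropy (Φc ρ) = entropy (envGram B ρ) := by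
  obtain ⟨V, -, hV⟩ := h
  have hentry : ∀ i j : a, ∀ k l : a, ∑ x, V (k, x) i * star (V (l, x) j) =
      B k l * (Matrix.single i j 1 : Matrix a a ℂ) k l := by
    intro i j k l
    have := congrFun (congrFun (hV (Matrix.single i j 1)).1 k) l
    rw [show B k l * (Matrix.single i j 1 : Matrix a a ℂ) k l =
      dephasing B (Matrix.single i j 1) k l from rfl, this]
    refine Finset.sum_congr rfl fun x _ => ?_
    simp [Matrix.mul_apply, Matrix.single_apply, ite_and]
  -- The squared norm of `x ↦ V (k, x) i` is the `(k, k)` entry of `Φ_B(E_ii)`, which is zero for `k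
  -- ≠ i`. Hence `V e_i = e_i ⊗ w_i`.
  have hoff : ∀ k i x, k ≠ i → V (k, x) i = 0 := by
    intro k i x hki
    have h0 : (fun x => V (k, x) i) = 0 := by
      rw [← dotProduct_self_star_eq_zero]
      refine (hentry i i k k).trans ?_
      simp [hki.symm]
    exact congrFun h0 x
  have hW : ∀ i j, ∑ x, V (i, x) i * star (V (j, x) j) = B i j := fun i j => by
    rw [hentry i j i j]; simp
  -- With `K` the matrix of columns `√ρᵢᵢ w_i`, the environment state is `K * Kᴴ` and `envGram B ρ`
  -- is `Kᴴ * K`.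
  rw [envGram_eq_conjTranspose_mul_self (W := Matrix.of fun x i => V (i, x) i) hW,
    ← entropy_self_mul_conjTranspose, (hV ρ).2]
  congr 1
  ext x y
  simp only [traceFst, Matrix.of_apply, Matrix.mul_apply, Matrix.conjTranspose_apply, star_mul']
  refine Finset.sum_congr rfl fun i _ => ?_
  rw [Finset.sum_eq_single i, Finset.sum_eq_single i]
  · rw [← hρ.sqrt_mul_sqrt_diag i]
    simp
    ring
  · intro j _ hj
    rw [hoff i j x hj.symm, zero_mul]
  · simp
  · intro j _ hj
    rw [hoff i j y hj.symm, star_zero, mul_zero]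
  · simp

theorem exists_isComplementary_dephasing {B : Matrix a a ℂ} (hB : IsCorrelation B) :
    ∃ (m : ℕ) (Φc : Matrix a a ℂ →ₗ[ℂ] Matrix (Fin m) (Fin m) ℂ),
      IsComplementary (dephasing B) Φc := by
  obtain ⟨W, hW⟩ := hB.exists_factor
  -- The isometry `e_i ↦ e_i ⊗ w_i`, with `w_i` the columns of a factor of `B`.
  let V : Matrix (a × Fin (Fintype.card a)) a ℂ := Matrix.of fun p i =>
    if p.1 = i then W ((Fintype.equivFin a).symm p.2) i else 0
  have hsum : ∀ i j, ∑ x, W ((Fintype.equivFin a).symm x) i *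
      star (W ((Fintype.equivFin a).symm x) j) = B i j := fun i j => by
    rw [← hW i j]
    exact Equiv.sum_comp (Fintype.equivFin a).symm fun x => W x i * star (W x j)
  refine ⟨Fintype.card a,
    { toFun := fun X => traceFst (V * X * Vᴴ)
      map_add' := fun X Y => ?_
      map_smul' := fun c X => ?_ }, V, ?_, fun X => ⟨?_, rfl⟩⟩
  · ext x y
    simp [traceFst, Matrix.mul_add, Matrix.add_mul, Finset.sum_add_distrib]
  · ext x y
    simp [traceFst, Finset.mul_sum]
  · ext i j
    rw [Matrix.mul_apply, Fintype.sum_prod_type]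
    by_cases hij : i = j
    · subst hij
      rw [Matrix.one_apply_eq, ← hB.diag_eq_one i, ← hsum i i, Finset.sum_eq_single i]
      · refine Finset.sum_congr rfl fun x _ => ?_
        simp [V, mul_comm]
      · intro k _ hk
        simp [V, hk]
      · simp
    · rw [Matrix.one_apply_ne hij]
      refine Finset.sum_eq_zero fun k _ => Finset.sum_eq_zero fun x _ => ?_
      by_cases hk : k = i
      · simp [V, hk, hij]
      · simp [V, hk]
  · ext k l
    change B k l * X k l = ∑ x, (V * X * Vᴴ) (k, x) (l, x)
    rw [← hsum k l, Finset.sum_mul]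
    refine Finset.sum_congr rfl fun x _ => ?_
    simp [Matrix.mul_apply, V, mul_right_comm, apply_ite]

/-- The coherent information of a dephasing channel, without reference to complementary
channels. -/
theorem coherentInfo_dephasing {B : Matrix a a ℂ} (hB : IsCorrelation B) :
    coherentInfo (dephasing B) =
      sSup {x : ℝ | ∃ ρ : Matrix a a ℂ, IsState ρ ∧
        x = entropy (dephasing B ρ) - entropy (envGram B ρ)} := by
  unfold coherentInfo
  congr 1
  ext x
  constructor
  · rintro ⟨m, Φc, ρ, hc, hρ, rfl⟩
    exact ⟨ρ, hρ, by rw [hc.entropy_eq hρ]⟩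
  · rintro ⟨ρ, hρ, rfl⟩
    obtain ⟨m, Φc, hc⟩ := exists_isComplementary_dephasing hB
    exact ⟨m, Φc, ρ, hc, hρ, by rw [hc.entropy_eq hρ]⟩

theorem entropy_sub_le_log_card {B ρ : Matrix a a ℂ} (hB : IsCorrelation B) (hρ : IsState ρ) :
    entropy (dephasing B ρ) - entropy (envGram B ρ) ≤ Real.log (Fintype.card a) := by
  linarith [(hρ.hadamard hB).entropy_le, (hρ.envGram hB).entropy_nonneg]

theorem bddAbove_coherentInfo {B : Matrix a a ℂ} (hB : IsCorrelation B) :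
    BddAbove {x : ℝ | ∃ ρ : Matrix a a ℂ, IsState ρ ∧
        x = entropy (dephasing B ρ) - entropy (envGram B ρ)} := by
  refine ⟨Real.log (Fintype.card a), ?_⟩
  rintro x ⟨ρ, hρ, rfl⟩
  exact entropy_sub_le_log_card hB hρ

theorem le_coherentInfo {B ρ : Matrix a a ℂ} (hB : IsCorrelation B) (hρ : IsState ρ) :
    entropy (dephasing B ρ) - entropy (envGram B ρ) ≤ coherentInfo (dephasing B) := by
  rw [coherentInfo_dephasing hB]
  exact le_csSup (bddAbove_coherentInfo hB) ⟨ρ, hρ, rfl⟩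

/-- The maximally mixed state. -/
theorem isState_maxMixed (a : Type*) [Fintype a] [DecidableEq a] [Nonempty a] :
    IsState (((Fintype.card a : ℂ)⁻¹) • (1 : Matrix a a ℂ)) where
  posSemidef := Matrix.PosSemidef.one.smul (by positivity)
  trace_eq_one := by simp [Matrix.trace_smul, Matrix.trace_one]

theorem coherentInfo_le [Nonempty a] {B : Matrix a a ℂ} (hB : IsCorrelation B) {c : ℝ}
    (h : ∀ ρ : Matrix a a ℂ, IsState ρ →
      entropy (dephasing B ρ) - entropy (envGram B ρ) ≤ c) :
    coherentInfo (dephasing B) ≤ c := by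
  rw [coherentInfo_dephasing hB]
  refine csSup_le ⟨_, _, isState_maxMixed a, rfl⟩ ?_
  rintro x ⟨ρ, hρ, rfl⟩
  exact h ρ hρ

omit [Fintype a] in
theorem isCorrelation_one : IsCorrelation (1 : Matrix a a ℂ) :=
  ⟨Matrix.PosSemidef.one, fun i => Matrix.one_apply_eq i⟩

/-- For `B = 1`, both `dephasing B ρ` and `envGram B ρ` are the diagonal part of `ρ`. -/
theorem coherentInfo_dephasing_one [Nonempty a] :
    coherentInfo (dephasing (1 : Matrix a a ℂ)) = 0 := by
  have h : ∀ ρ : Matrix a a ℂ, IsState ρ →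
      entropy (dephasing 1 ρ) - entropy (envGram 1 ρ) = 0 := by
    intro ρ hρ
    rw [sub_eq_zero]
    congr 1
    ext i j
    by_cases hij : i = j
    · subst hij
      simp [dephasing, envGram, hρ.sqrt_mul_sqrt_diag]
    · simp [dephasing, envGram, hij, Ne.symm hij]
  refine le_antisymm (coherentInfo_le isCorrelation_one fun ρ hρ => (h ρ hρ).le) ?_
  rw [← h _ (isState_maxMixed a)]
  exact le_coherentInfo isCorrelation_one (isState_maxMixed a)

theorem coherentInfo_dephasing_pos [Nonempty a] {B : Matrix a a ℂ} (hB : IsCorrelation B)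
    (h1 : B ≠ 1) : 0 < coherentInfo (dephasing B) := by
  have hc : (0 : ℝ) < Fintype.card a := by exact_mod_cast Fintype.card_pos
  have hm := isState_maxMixed a
  refine lt_of_lt_of_le ?_ (le_coherentInfo hB hm)
  have hΦ : dephasing B (((Fintype.card a : ℂ)⁻¹) • (1 : Matrix a a ℂ)) =
      Matrix.diagonal fun _ => (((Fintype.card a : ℝ)⁻¹ : ℝ) : ℂ) := by
    ext i j
    by_cases hij : i = j
    · subst hij
      simp [dephasing, hB.diag_eq_one]
    · simp [dephasing, hij]
  have hR : envGram B (((Fintype.card a : ℂ)⁻¹) • (1 : Matrix a a ℂ)) =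
      ((Fintype.card a : ℂ)⁻¹) • Bᵀ := by
    ext i j
    have : ((Fintype.card a : ℂ)⁻¹).re = (Fintype.card a : ℝ)⁻¹ := by
      rw [← Complex.ofReal_natCast, ← Complex.ofReal_inv, Complex.ofReal_re]
    simp [envGram, this, ← mul_inv, Real.mul_self_sqrt hc.le]
  have hS : entropy (dephasing B (((Fintype.card a : ℂ)⁻¹) • (1 : Matrix a a ℂ))) =
      Real.log (Fintype.card a) := by
    rw [hΦ, entropy_diagonal]
    simp [Real.negMulLog, hc.ne']
  rw [hS, sub_pos]
  refine lt_of_le_of_ne (hm.envGram hB).entropy_le fun he => h1 ?_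
  have := (hm.envGram hB).eq_of_entropy_eq he
  rw [hR] at this
  have h2 := smul_right_injective (Matrix a a ℂ)
    (inv_ne_zero (Nat.cast_ne_zero.mpr (Fintype.card_ne_zero (α := a)))) this
  rw [← Matrix.transpose_transpose B, h2, Matrix.transpose_one]

/-- Superadditivity of the coherent information of dephasing channels. -/
theorem add_coherentInfo_le [Nonempty a] [Nonempty b] {c : Type*} [Fintype c] [DecidableEq c]
    {B : Matrix a a ℂ} {C : Matrix b b ℂ} (hB : IsCorrelation B) (hC : IsCorrelation C)
    (e : c ≃ a × b) (hBC : IsCorrelation ((B ⊗ₖ C).submatrix e e)) :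
    coherentInfo (dephasing B) + coherentInfo (dephasing C) ≤
      coherentInfo (dephasing ((B ⊗ₖ C).submatrix e e)) := by
  rw [← le_sub_iff_add_le]
  -- The two suprema are eliminated one after the other, leaving a single product input `ρ ⊗ σ`.
  refine coherentInfo_le hB fun ρ hρ => ?_
  rw [le_sub_comm]
  refine coherentInfo_le hC fun σ hσ => ?_
  rw [le_sub_iff_add_le]
  have hΦ : dephasing ((B ⊗ₖ C).submatrix e e) ((ρ ⊗ₖ σ).submatrix e e) =
      (dephasing B ρ ⊗ₖ dephasing C σ).submatrix e e := by
    ext i j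
    simp [dephasing, mul_mul_mul_comm]
  have hre : ∀ i j, (ρ i i * σ j j).re = (ρ i i).re * (σ j j).re := fun i j => by
    rw [← hρ.ofReal_diag_re, ← hσ.ofReal_diag_re, ← Complex.ofReal_mul, Complex.ofReal_re,
      Complex.ofReal_re, Complex.ofReal_re]
  have hR : envGram ((B ⊗ₖ C).submatrix e e) ((ρ ⊗ₖ σ).submatrix e e) =
      (envGram B ρ ⊗ₖ envGram C σ).submatrix e e := by
    ext i j
    simp only [envGram, Matrix.of_apply, Matrix.submatrix_apply, Matrix.kroneckerMap_apply, hre,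
      Real.sqrt_mul (hρ.diag_re_nonneg _), Complex.ofReal_mul]
    ring
  have hle := le_coherentInfo hBC ((hρ.kronecker hσ).submatrix_equiv e)
  rw [hΦ, hR, entropy_submatrix_equiv
      ((hρ.hadamard hB).kronecker (hσ.hadamard hC)).posSemidef.1,
    entropy_submatrix_equiv ((hρ.envGram hB).kronecker (hσ.envGram hC)).posSemidef.1,
    (hρ.hadamard hB).entropy_kronecker (hσ.hadamard hC),
    (hρ.envGram hB).entropy_kronecker (hσ.envGram hC)] at hle
  linarith

end Dephasing

/-! ### Tensor powers and the regularized limit. -/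

section TensorPower

/-- The tensor power `B^{⊗ n}` of a matrix, indexed by `Fin n → a`. -/
def powMatrix {a : Type*} (B : Matrix a a ℂ) (n : ℕ) : Matrix (Fin n → a) (Fin n → a) ℂ :=
  Matrix.of fun k l => ∏ t, B (k t) (l t)

variable {a : Type*} [Fintype a] [DecidableEq a]

theorem tensorPower_dephasing (B : Matrix a a ℂ) (n : ℕ) :
    tensorPower (dephasing B) n = dephasing (powMatrix B n) := by
  refine LinearMap.ext fun X => ?_
  ext k l
  change ∑ i, ∑ j, X i j * ∏ t, B (k t) (l t) * (Matrix.single (i t) (j t) 1 : Matrix a a ℂ)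
    (k t) (l t) = (∏ t, B (k t) (l t)) * X k l
  rw [Finset.sum_eq_single k, Finset.sum_eq_single l]
  · simp [mul_comm]
  · intro j _ hj
    obtain ⟨t, ht⟩ := Function.ne_iff.mp hj
    rw [Finset.prod_eq_zero (Finset.mem_univ t) (by simp [ht]), mul_zero]
  · simp
  · intro i _ hi
    obtain ⟨t, ht⟩ := Function.ne_iff.mp hi
    refine Finset.sum_eq_zero fun j _ => ?_
    rw [Finset.prod_eq_zero (Finset.mem_univ t) (by simp [ht]), mul_zero]
  · simp

omit [Fintype a] [DecidableEq a] in
theorem powMatrix_add (B : Matrix a a ℂ) (m n : ℕ) :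
    powMatrix B (m + n) = (powMatrix B m ⊗ₖ powMatrix B n).submatrix
      (Fin.appendEquiv m n).symm (Fin.appendEquiv m n).symm := by
  ext k l
  simp [powMatrix, Fin.prod_univ_add]

omit [DecidableEq a] in
theorem IsCorrelation.powMatrix {B : Matrix a a ℂ} (hB : IsCorrelation B) (n : ℕ) :
    IsCorrelation (powMatrix B n) where
  posSemidef := by
    obtain ⟨K, hK⟩ := hB.posSemidef.exists_eq_conjTranspose_mul_self
    have : QChannel.powMatrix B n = (QChannel.powMatrix K n)ᴴ * QChannel.powMatrix K n := by
      classical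
      ext k l
      simp only [QChannel.powMatrix, Matrix.of_apply, Matrix.mul_apply,
        Matrix.conjTranspose_apply, hK, star_prod, ← Finset.prod_mul_distrib]
      rw [Finset.prod_univ_sum, Fintype.piFinset_univ]
    rw [this]
    exact Matrix.posSemidef_conjTranspose_mul_self _
  diag_eq_one k := by simp [QChannel.powMatrix, hB.diag_eq_one]

omit [Fintype a] in
theorem powMatrix_one (n : ℕ) : powMatrix (1 : Matrix a a ℂ) n = 1 := by
  ext k l
  by_cases h : k = l
  · subst h
    simp [powMatrix]
  · obtain ⟨t, ht⟩ := Function.ne_iff.mp h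
    rw [Matrix.one_apply_ne h]
    exact Finset.prod_eq_zero (Finset.mem_univ t) (Matrix.one_apply_ne ht)

omit [Fintype a] in
theorem eq_one_of_powMatrix_one {B : Matrix a a ℂ} (h : powMatrix B 1 = 1) : B = 1 := by
  ext i j
  have := congrFun (congrFun h fun _ => i) fun _ => j
  simpa [powMatrix, Matrix.one_apply, funext_iff] using this

variable [Nonempty a] {B : Matrix a a ℂ}

/-- The sign turns superadditivity into the hypothesis of Fekete's lemma. -/
theorem subadditive_neg_coherentInfo (hB : IsCorrelation B) :
    Subadditive fun n => -coherentInfo (tensorPower (dephasing B) n) := by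
  intro m n
  have h := add_coherentInfo_le (hB.powMatrix m) (hB.powMatrix n) (Fin.appendEquiv m n).symm
    (by rw [← powMatrix_add]; exact hB.powMatrix _)
  rw [← powMatrix_add] at h
  simp only [tensorPower_dephasing]
  linarith

theorem bddBelow_neg_coherentInfo_div (hB : IsCorrelation B) :
    BddBelow (Set.range fun n : ℕ => -coherentInfo (tensorPower (dephasing B) n) / n) := by
  refine ⟨-Real.log (Fintype.card a), ?_⟩
  rintro _ ⟨n, rfl⟩
  have hlog : 0 ≤ Real.log (Fintype.card a) := Real.log_natCast_nonneg _
  rcases Nat.eq_zero_or_pos n with rfl | hn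
  -- At `n = 0` the quotient is `0` by the convention for division by zero.
  · simpa using hlog
  have h : coherentInfo (tensorPower (dephasing B) n) ≤ n * Real.log (Fintype.card a) := by
    rw [tensorPower_dephasing]
    refine coherentInfo_le (hB.powMatrix n) fun ρ hρ => ?_
    simpa using entropy_sub_le_log_card (hB.powMatrix n) hρ
  have hn' : (0 : ℝ) < n := by exact_mod_cast hn
  rw [le_div_iff₀ hn']
  linarith

theorem tendsto_coherentInfo_div (hB : IsCorrelation B) :
    Tendsto (fun n : ℕ => coherentInfo (tensorPower (dephasing B) n) / n) atTop
      (𝓝 (-(subadditive_neg_coherentInfo hB).lim)) := by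
  simpa [neg_div] using ((subadditive_neg_coherentInfo hB).tendsto_lim
    (bddBelow_neg_coherentInfo_div hB)).neg

theorem quantumCapacity_dephasing (hB : IsCorrelation B) :
    quantumCapacity (dephasing B) = -(subadditive_neg_coherentInfo hB).lim :=
  (tendsto_coherentInfo_div hB).limUnder_eq

theorem quantumCapacity_dephasing_eq_zero_iff (hB : IsCorrelation B) :
    quantumCapacity (dephasing B) = 0 ↔ B = 1 := by
  constructor
  · intro h
    by_contra h1
    -- The Fekete limit is an infimum, so the term `n = 1` alone bounds the capacity away from `0`.
    have hpos := coherentInfo_dephasing_pos (hB.powMatrix 1) fun h => h1 (eq_one_of_powMatrix_one h)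
    have hle := (subadditive_neg_coherentInfo hB).lim_le_div (bddBelow_neg_coherentInfo_div hB)
      one_ne_zero
    rw [quantumCapacity_dephasing hB] at h
    rw [tensorPower_dephasing] at hle
    simp only [Nat.cast_one, div_one] at hle
    linarith
  · rintro rfl
    refine Tendsto.limUnder_eq (tendsto_const_nhds.congr fun n => ?_)
    rw [tensorPower_dephasing, powMatrix_one, coherentInfo_dephasing_one, zero_div]

end TensorPower

/-! ### Entanglement-breaking and PPT dephasing channels. -/

section Entanglement

variable {a : Type*} [Fintype a] [DecidableEq a] {B : Matrix a a ℂ}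

omit [Fintype a] in
theorem choi_dephasing_apply (B : Matrix a a ℂ) (p q : a × a) :
    choi (dephasing B) p q = B p.1 q.1 * if p.1 = p.2 ∧ q.1 = q.2 then 1 else 0 := by
  simp [choi, ampliation, dephasing, maxEntangled, Matrix.vecMulVec_apply, ite_and]
  split_ifs <;> rfl

theorem IsCorrelation.eq_one_of_isSeparable (hB : IsCorrelation B)
    (h : IsSeparable (choi (dephasing B))) : B = 1 := by
  obtain ⟨m, P, R, hP, hR, hsum⟩ := h
  have hentry : ∀ p q : a × a, ∑ k, P k p.1 q.1 * R k p.2 q.2 =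
      B p.1 q.1 * if p.1 = p.2 ∧ q.1 = q.2 then 1 else 0 := fun p q => by
    rw [← choi_dephasing_apply, hsum, Matrix.sum_apply]
    rfl
  ext i j
  by_cases hij : i = j
  · rw [hij, hB.diag_eq_one, Matrix.one_apply_eq]
  -- For `i ≠ j` the Choi matrix has a zero at the diagonal position `(i, j)`, and it is a sum of
  -- nonnegative terms there. In each term `P k i i = 0` or `R k j j = 0`, which kills `P k i j` or
  -- `R k i j`; the sum of their products is `B i j`.
  have hzero : ∀ k, P k i i * R k j j = 0 := fun k =>
    (Finset.sum_eq_zero_iff_of_nonneg fun k _ =>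
      mul_nonneg (hP k).diag_nonneg (hR k).diag_nonneg).mp
      ((hentry (i, j) (i, j)).trans (by simp [hij])) k (Finset.mem_univ k)
  have hs := hentry (i, i) (j, j)
  simp only [and_self, if_true, mul_one] at hs
  rw [Matrix.one_apply_ne hij, ← hs]
  refine Finset.sum_eq_zero fun k _ => ?_
  rcases mul_eq_zero.mp (hzero k) with h | h
  · rw [(hP k).apply_eq_zero_of_diag_eq_zero h j, zero_mul]
  · rw [← (hR k).1.apply i j, (hR k).apply_eq_zero_of_diag_eq_zero h i, star_zero, mul_zero]

theorem isEntanglementBreaking_dephasing_one :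
    IsEntanglementBreaking (dephasing (1 : Matrix a a ℂ)) := by
  refine ⟨isChannel_dephasing isCorrelation_one, Fintype.card a,
    fun k => Matrix.single ((Fintype.equivFin a).symm k) ((Fintype.equivFin a).symm k) 1,
    fun k => Matrix.single ((Fintype.equivFin a).symm k) ((Fintype.equivFin a).symm k) 1,
    fun k => ?_, fun k => ?_, ?_⟩
  iterate 2
    beta_reduce
    rw [← Matrix.diagonal_single]
    exact Matrix.PosSemidef.diagonal (Pi.single_nonneg.mpr zero_le_one)
  ext p q
  rw [choi_dephasing_apply, Matrix.sum_apply, Equiv.sum_comp (Fintype.equivFin a).symm fun i : a =>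
    ((Matrix.single i i 1 : Matrix a a ℂ) ⊗ₖ (Matrix.single i i 1 : Matrix a a ℂ)) p q]
  rw [Finset.sum_eq_single p.1]
  · simp only [Matrix.kroneckerMap_apply, Matrix.single_apply, Matrix.one_apply]
    grind
  · intro i _ hi
    simp [hi]
  · simp

theorem isPPT_dephasing_one : IsPPT (dephasing (1 : Matrix a a ℂ)) := by
  have h : transposeMap a ∘ₗ dephasing (1 : Matrix a a ℂ) = dephasing 1 := by
    refine LinearMap.ext fun X => ?_
    ext i j
    by_cases hij : i = j
    · simp [transposeMap, dephasing, hij]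
    · simp [transposeMap, dephasing, hij, Ne.symm hij]
  refine ⟨isChannel_dephasing isCorrelation_one, ?_⟩
  rw [h]
  exact isChannel_dephasing isCorrelation_one

/-- The partially transposed Choi matrix is zero at the diagonal position `(j, i)` but carries `B i
j` in that row, at column `(i, j)`. The index type is `Fin d` because complete positivity is tested
on ancillas `Fin n`. -/
theorem IsCorrelation.eq_one_of_isPPT {d : ℕ} {B : Matrix (Fin d) (Fin d) ℂ}
    (hB : IsCorrelation B) (h : IsPPT (dephasing B)) : B = 1 := by
  have hM := h.2.completelyPositive d (maxEntangled (Fin d))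
    (Matrix.posSemidef_vecMulVec_self_star _)
  have hentry : ∀ p q, ampliation (Fin d) (transposeMap (Fin d) ∘ₗ dephasing B)
      (maxEntangled (Fin d)) p q = B q.1 p.1 * if q.1 = p.2 ∧ p.1 = q.2 then 1 else 0 := by
    intro p q
    simp [ampliation, transposeMap, dephasing, maxEntangled, Matrix.vecMulVec_apply, ite_and]
    split_ifs <;> rfl
  ext i j
  by_cases hij : i = j
  · rw [hij, hB.diag_eq_one, Matrix.one_apply_eq]
  have := hM.apply_eq_zero_of_diag_eq_zero (i := (j, i)) (by simp [hentry, Ne.symm hij]) (i, j)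
  rw [hentry] at this
  rw [Matrix.one_apply_ne hij]
  simpa using this

end Entanglement

end

end QChannel

theorem theorem4p9 (d : ℕ) (hd : 0 < d) (B : Matrix (Fin d) (Fin d) ℂ)
    (hB : QChannel.IsCorrelation B) :
    Tendsto (fun n : ℕ =>
        QChannel.coherentInfo (QChannel.tensorPower (QChannel.dephasing B) n) / n)
      atTop (𝓝 (QChannel.quantumCapacity (QChannel.dephasing B))) ∧
    List.TFAE [
      QChannel.quantumCapacity (QChannel.dephasing B) = 0,
      QChannel.IsEntanglementBreaking (QChannel.dephasing B),
      QChannel.IsPPT (QChannel.dephasing B),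
      B = 1] := by
  have : Nonempty (Fin d) := ⟨⟨0, hd⟩⟩
  refine ⟨?_, ?_⟩
  · rw [QChannel.quantumCapacity_dephasing hB]
    exact QChannel.tendsto_coherentInfo_div hB
  · tfae_have 1 ↔ 4 := QChannel.quantumCapacity_dephasing_eq_zero_iff hB
    tfae_have 2 → 4 := fun h => hB.eq_one_of_isSeparable h.2
    tfae_have 3 → 4 := hB.eq_one_of_isPPT
    tfae_have 4 → 2 := by
      rintro rfl
      exact QChannel.isEntanglementBreaking_dephasing_one
    tfae_have 4 → 3 := by
      rintro rfl
      exact QChannel.isPPT_dephasing_one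
    tfae_finish
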